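/- Let $k$ be a finite field of characteristic $p$, let $m\ge 1$, $\mathcal G=M_{2m}(k)$ and $G=\mathrm{GL}_{2m}(k)$. Let $R$ be a field of characteristic different from $p$ and let $\psi:k\to R^\times$ be a non-trivial character. Consider one of the following two cases. - (Linear case) $p$ is odd, $\mathcal H=M_m(k)\times M_m(k)$ and $H=\mathrm{GL}_m(k)\times \mathrm{GL}_m(k)$, embedded block-diagonally in $\mathcal G$, and $w=\begin{pmatrix}0&1_m\\1_m&0\end{pmatrix}$. - (Twisted linear case) $l=k[\sqrt\alpha]$ is a quadratic extension of $k$, with $\alpha\in k^\times$ not a square (so that $p$ is odd), $\mathcal H=M_m(l)$ and $H=\mathrm{GL}_m(l)$, embedded in $\mathcal G$ by $x+y\sqrt\alpha\mapsto\begin{pmatrix}x&y\\ \alpha y&x\end{pmatrix}$ for $x,y\in M_m(k)$, and $w=\begin{pmatrix}1_m&0\\0&-1_m\end{pmatrix}$. Let $(\pi,V)$ be an absolutely irreducible representation of $G$ over $R$ that is cuspidal (the coinvariants $V_U$ vanish for the unipotent radical $U$ of every proper parabolic subgroup of $G$) and $H$-distinguished ($\mathrm{Hom}_{R[H]}(\pi,R)\neq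 0$). Put $|\mathcal G|^{1/2}:=|\mathcal H|$ in $R$, and for $\Phi:\mathcal G\to R$ let $$\widehat\Phi(a)=|\mathcal G|^{-1/2}\sum_{g\in\mathcal G}\Phi(g)\,\psi(\mathrm{tr}(ga)).$$ Then $\pi$ has a Godement–Jacquet gamma factor $\gamma(\pi,\psi)$, that is, a (necessarily unique) $\gamma(\pi,\psi)\in R$ such that $$\sum_{g\in G}\widehat\Phi(g)\,v^\vee(\pi(g^{-1})v)=\gamma(\pi,\psi)\sum_{g\in G}\Phi(g)\,v^\vee(\pi(g)v)$$ for all $v\in V$, $v^\vee\in\mathrm{Hom}_R(V,R)$ and all $\Phi:\mathcal G\to R$ supported in $G$. The normalizer $N_G(H)$ acts on the non-zero space $\mathrm{Hom}_{R[H]}(\pi,R)$ by a character $\chi_\pi:N_G(H)\to R^\times$, that is, $\Lambda\circ\pi(n)=\chi_\pi(n)\Lambda$ for all $n\in N_G(H)$ and all $\Lambda\in\mathrm{Hom}_{R[H]}(\pi,R)$. The element $w$ lies in $N_G(H)$, and $$\gamma(\pi,\psi)=\chi_\pi(w).$$ -/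

import Mathlib

open Matrix

noncomputable section

namespace GJ

/-! ### Representations of a group over a field `R` -/

section Representations

variable {R G V : Type*} [Field R] [Group G] [AddCommGroup V] [Module R V]

/-- The representation `R' ⊗ V` of `G` over an extension field `R'` of `R`. -/
def extendScalars (R' : Type*) [Field R'] [Algebra R R'] (π : Representation R G V) :
    Representation R' G (TensorProduct R R' V) :=
  (Module.End.baseChangeHom R R' V : Module.End R V →* _).comp π

/-- `π` stays irreducible after extending scalars to an algebraic closure of `R`. -/
def IsAbsolutelyIrreducible (π : Representation R G V) : Prop :=
  (extendScalars (AlgebraicClosure R) π).IsIrreducible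

/-- The space `Hom_{R[H]}(π, R)` of `H`-invariant linear forms on `V`. -/
def invariantForms (π : Representation R G V) (H : Subgroup G) :
    Submodule R (Module.Dual R V) where
  carrier := {L | ∀ h ∈ H, ∀ v, L (π h v) = L v}
  add_mem' ha hb h hh v := by simp [ha h hh v, hb h hh v]
  zero_mem' _ _ _ := rfl
  smul_mem' c L hL h hh v := by simp [hL h hh v]

/-- `π` is distinguished by `H`: there is a non-zero `H`-invariant linear form. -/
def IsDistinguished (π : Representation R G V) (H : Subgroup G) : Prop :=
  invariantForms π H ≠ ⊥

/-- The character `χ` of the normalizer `N` of `H` is the one by which `N` acts on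
`Hom_{R[H]}(π, R)`: `L ∘ π(n) = χ(n) L` for all `n` in `N` and all `H`-invariant forms `L`. -/
def IsPeriodCharacter (π : Representation R G V) (H : Subgroup G)
    (χ : Subgroup.normalizer (H : Set G) →* Rˣ) : Prop :=
  ∀ n : Subgroup.normalizer (H : Set G), ∀ L ∈ invariantForms π H,
    L ∘ₗ π (n : G) = (χ n : R) • L

/-- The matrix coefficient `f_{v, L}(g) = L(π(g) v)`. -/
def matrixCoeff (π : Representation R G V) (v : V) (L : Module.Dual R V) (g : G) : R :=
  L (π g v)

end Representations

/-! ### Parabolic subgroups of `GL` and cuspidality -/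

section Cuspidal

variable {k : Type*} [Field k] {ι : Type*} [Fintype ι] [DecidableEq ι]

/-- A flag `0 = F₀ < F₁ < ⋯ < F_r = k^ι`. Parabolic subgroups of `GL ι k` are the stabilizers of
such flags, and the stabilizer is a proper subgroup exactly if `2 ≤ r`. -/
structure Flag (k ι : Type*) [Field k] [Fintype ι] (r : ℕ) where
  /-- the members of the flag -/
  space : Fin (r + 1) → Submodule k (ι → k)
  strictMono : StrictMono space
  space_zero : space 0 = ⊥
  space_last : space (Fin.last r) = ⊤

/-- The unipotent radical of the stabilizer of a flag: the `g` that act trivially on all the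
quotients `F_{i+1} / F_i` (which implies that they stabilize the flag). -/
def Flag.unipotentRadical {r : ℕ} (F : Flag k ι r) : Subgroup (GL ι k) where
  carrier := {g | ∀ i : Fin r, ∀ x ∈ F.space i.succ,
    (g : Matrix ι ι k) *ᵥ x - x ∈ F.space i.castSucc}
  one_mem' := by
    intro i x _
    simp
  mul_mem' := by
    intro g h hg hh i x hx
    have hle : F.space i.castSucc ≤ F.space i.succ :=
      F.strictMono.monotone (Fin.castSucc_lt_succ).le
    have h1 := hh i x hx
    have h2 : (h : Matrix ι ι k) *ᵥ x ∈ F.space i.succ := by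
      simpa using (F.space i.succ).add_mem (hle h1) hx
    have h3 := (F.space i.castSucc).add_mem (hg i _ h2) h1
    simpa [Matrix.mulVec_mulVec] using h3
  inv_mem' := by
    intro g hg
    -- `g` maps every member of the flag onto itself, as the members are finite-dimensional
    have key : ∀ j : Fin (r + 1), ∀ x ∈ F.space j,
        ((g⁻¹ : GL ι k) : Matrix ι ι k) *ᵥ x ∈ F.space j := by
      intro j x hx
      have hst : ∀ y ∈ F.space j, (Matrix.mulVecLin (g : Matrix ι ι k)) y ∈ F.space j := by
        refine Fin.cases ?_ (fun i => ?_) j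
        · intro y hy
          rw [F.space_zero, Submodule.mem_bot] at hy
          simp [hy]
        · intro y hy
          have hle : F.space i.castSucc ≤ F.space i.succ :=
            F.strictMono.monotone (Fin.castSucc_lt_succ).le
          simpa using (F.space i.succ).add_mem (hle (hg i y hy)) hy
      have hinj : Function.Injective
          ((Matrix.mulVecLin (g : Matrix ι ι k)).restrict hst) := by
        intro a b hab
        have h1 : (g : Matrix ι ι k) *ᵥ (a : ι → k) = (g : Matrix ι ι k) *ᵥ (b : ι → k) :=
          congrArg Subtype.val hab
        have h2 := congrArg (fun y => ((g⁻¹ : GL ι k) : Matrix ι ι k) *ᵥ y) h1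
        have h3 : ((g⁻¹ : GL ι k) : Matrix ι ι k) * (g : Matrix ι ι k) = 1 := g.inv_mul
        simp only [Matrix.mulVec_mulVec, h3, Matrix.one_mulVec] at h2
        exact Subtype.ext h2
      obtain ⟨y, hy⟩ := LinearMap.surjective_of_injective hinj ⟨x, hx⟩
      have h1 : (g : Matrix ι ι k) *ᵥ (y : ι → k) = x := congrArg Subtype.val hy
      have h3 : ((g⁻¹ : GL ι k) : Matrix ι ι k) * (g : Matrix ι ι k) = 1 := g.inv_mul
      rw [← h1, Matrix.mulVec_mulVec, h3, Matrix.one_mulVec]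
      exact y.2
    intro i x hx
    have h1 := (F.space i.castSucc).neg_mem (hg i _ (key i.succ x hx))
    have h3 : (g : Matrix ι ι k) * ((g⁻¹ : GL ι k) : Matrix ι ι k) = 1 := g.mul_inv
    simpa [Matrix.mulVec_mulVec, h3] using h1

/-- `π` is cuspidal: the coinvariants `V_U` vanish for the unipotent radical `U` of every proper
parabolic subgroup. -/
def IsCuspidal {R V : Type*} [Field R] [AddCommGroup V] [Module R V]
    (π : Representation R (GL ι k) V) : Prop :=
  ∀ (r : ℕ), 2 ≤ r → ∀ F : Flag k ι r,
    Subsingleton (Representation.Coinvariants (π.comp F.unipotentRadical.subtype))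

end Cuspidal

/-! ### Godement–Jacquet sums and gamma factors -/

section Gamma

variable {k : Type*} [Field k] [Fintype k] [DecidableEq k]
variable {ι : Type*} [Fintype ι] [DecidableEq ι] {R : Type*} [Field R]

/-- The Fourier transform `Φ̂(a) = s⁻¹ ∑_g Φ(g) ψ(tr(g a))` on functions on the matrix algebra, where
`s` is the chosen square root of the cardinality of the matrix algebra. -/
def fourier (ψ : AddChar k R) (s : R) (Φ : Matrix ι ι k → R) (a : Matrix ι ι k) : R :=
  s⁻¹ * ∑ g : Matrix ι ι k, Φ g * ψ (Matrix.trace (g * a))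

/-- The Godement–Jacquet sum `Z(Φ, f) = ∑_{g ∈ GL} Φ(g) f(g)`. -/
def zeta (Φ : Matrix ι ι k → R) (f : GL ι k → R) : R :=
  ∑ g : GL ι k, Φ (g : Matrix ι ι k) * f g

variable {V : Type*} [AddCommGroup V] [Module R V]

/-- `c` is a proportionality constant in the Godement–Jacquet functional equation of `π`:
`Z(Φ̂, f^∨) = c Z(Φ, f)` with `f^∨(g) = f(g⁻¹)`, for all `Φ` supported in `GL` and all matrix
coefficients `f` of `π`. -/
def FunctionalEquation (ψ : AddChar k R) (s : R) (π : Representation R (GL ι k) V) (c : R) :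
    Prop :=
  ∀ Φ : Matrix ι ι k → R, (∀ x, ¬ IsUnit x → Φ x = 0) →
    ∀ (v : V) (L : Module.Dual R V),
      zeta (fourier ψ s Φ) (fun g => matrixCoeff π v L g⁻¹) = c * zeta Φ (matrixCoeff π v L)

/-- `π` satisfies the Godement–Jacquet functional equation with respect to `ψ`. -/
def SatisfiesFunctionalEquation (ψ : AddChar k R) (s : R) (π : Representation R (GL ι k) V) :
    Prop :=
  ∃ c : R, FunctionalEquation ψ s π c

open Classical in
/-- The gamma factor `γ(π, ψ)`: the constant in the functional equation (it is unique if `V ≠ 0`);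
by convention `0` if `π` does not satisfy the functional equation. -/
def gammaFactor (ψ : AddChar k R) (s : R) (π : Representation R (GL ι k) V) : R :=
  if h : SatisfiesFunctionalEquation ψ s π then h.choose else 0

end Gamma

/-! ### The linear and the twisted linear model -/

section Models

variable (k : Type*) [Field k] (m : ℕ)

/-- The block diagonal embedding `M_m(k) × M_m(k) → M_{2m}(k)`. -/
def linearEmb : (Matrix (Fin m) (Fin m) k × Matrix (Fin m) (Fin m) k) →+*
    Matrix (Fin m ⊕ Fin m) (Fin m ⊕ Fin m) k where
  toFun A := Matrix.fromBlocks A.1 0 0 A.2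
  map_one' := by simp
  map_mul' A B := by simp [Matrix.fromBlocks_multiply]
  map_zero' := by simp
  map_add' A B := by simp [Matrix.fromBlocks_add]

/-- The embedding `M_m(l) → M_{2m}(k)` for `l = k[√α]`, which sends `x + y√α` with
`x, y ∈ M_m(k)` to the block matrix `(x, y; α y, x)`. Here `QuadraticAlgebra k α 0` is
`k ⊕ k√α`, with coordinates `re` and `im`. -/
def twistedEmb (α : k) : Matrix (Fin m) (Fin m) (QuadraticAlgebra k α 0) →+*
    Matrix (Fin m ⊕ Fin m) (Fin m ⊕ Fin m) k where
  toFun A := Matrix.fromBlocks (A.map QuadraticAlgebra.re) (A.map QuadraticAlgebra.im)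
    (α • A.map QuadraticAlgebra.im) (A.map QuadraticAlgebra.re)
  map_one' := by
    ext i j
    rcases i with i | i <;> rcases j with j | j <;>
      by_cases h : i = j <;> simp [Matrix.one_apply, h, QuadraticAlgebra.re_one,
        QuadraticAlgebra.im_one]
  map_mul' A B := by
    have hre : ∀ s : Finset (Fin m), ∀ f : Fin m → QuadraticAlgebra k α 0,
        (∑ i ∈ s, f i).re = ∑ i ∈ s, (f i).re := fun s f => by
      induction s using Finset.induction_on with
      | empty => simp
      | insert a s ha ih => simp [Finset.sum_insert ha, ih]
    have him : ∀ s : Finset (Fin m), ∀ f : Fin m → QuadraticAlgebra k α 0,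
        (∑ i ∈ s, f i).im = ∑ i ∈ s, (f i).im := fun s f => by
      induction s using Finset.induction_on with
      | empty => simp
      | insert a s ha ih => simp [Finset.sum_insert ha, ih]
    rw [Matrix.fromBlocks_multiply]
    congr 1 <;> ext i j <;>
      simp [Matrix.mul_apply, hre, him, Finset.mul_sum, ← Finset.sum_add_distrib] <;>
      refine Finset.sum_congr rfl fun x _ => ?_ <;> ring
  map_zero' := by
    ext i j
    rcases i with i | i <;> rcases j with j | j <;> simp
  map_add' A B := by
    ext i j
    rcases i with i | i <;> rcases j with j | j <;> simp [mul_add]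

/-- The algebra `ℋ = M_m(k) × M_m(k)` inside `M_{2m}(k)`. -/
def linearAlg : Subring (Matrix (Fin m ⊕ Fin m) (Fin m ⊕ Fin m) k) :=
  (linearEmb k m).range

/-- The subgroup `H = GL_m(k) × GL_m(k)` of `GL_{2m}(k)`. -/
def linearH : Subgroup (GL (Fin m ⊕ Fin m) k) :=
  (Units.map (linearEmb k m).toMonoidHom).range

/-- The algebra `ℋ = M_m(l)` inside `M_{2m}(k)`, for `l = k[√α]`. -/
def twistedAlg (α : k) : Subring (Matrix (Fin m ⊕ Fin m) (Fin m ⊕ Fin m) k) :=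
  (twistedEmb k m α).range

/-- The subgroup `H = GL_m(l)` of `GL_{2m}(k)`, for `l = k[√α]`. -/
def twistedH (α : k) : Subgroup (GL (Fin m ⊕ Fin m) k) :=
  (Units.map (twistedEmb k m α).toMonoidHom).range

/-- The element `antidiag(1_m, 1_m)`. -/
def antidiagW : GL (Fin m ⊕ Fin m) k where
  val := Matrix.fromBlocks 0 1 1 0
  inv := Matrix.fromBlocks 0 1 1 0
  val_inv := by simp [Matrix.fromBlocks_multiply]
  inv_val := by simp [Matrix.fromBlocks_multiply]

/-- The element `diag(1_m, -1_m)`. -/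
def diagW : GL (Fin m ⊕ Fin m) k where
  val := Matrix.fromBlocks 1 0 0 (-1)
  inv := Matrix.fromBlocks 1 0 0 (-1)
  val_inv := by simp [Matrix.fromBlocks_multiply]
  inv_val := by simp [Matrix.fromBlocks_multiply]

lemma mem_normalizer_of_involution {G : Type*} [Group G] (H : Subgroup G) (w : G)
    (hw1 : w⁻¹ = w) (hw : ∀ h ∈ H, w * h * w⁻¹ ∈ H) :
    w ∈ Subgroup.normalizer (H : Set G) := by
  rw [Subgroup.mem_normalizer_iff]
  intro h
  refine ⟨hw h, fun hh => ?_⟩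
  have h2 := hw _ hh
  have h3 : w * w = 1 := by
    nth_rewrite 1 [← hw1]
    exact inv_mul_cancel w
  have h4 : w * (w * h * w⁻¹) * w⁻¹ = (w * w) * h * (w * w)⁻¹ := by group
  rw [h4, h3] at h2
  simpa using h2

lemma antidiagW_mem_normalizer :
    antidiagW k m ∈ Subgroup.normalizer (linearH k m : Set (GL (Fin m ⊕ Fin m) k)) := by
  refine mem_normalizer_of_involution _ _ rfl ?_
  rintro _ ⟨A, rfl⟩
  refine ⟨Units.map (RingHom.toMonoidHom (RingEquiv.prodComm.toRingHom)) A, ?_⟩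
  apply Units.ext
  change Matrix.fromBlocks (A : Matrix (Fin m) (Fin m) k × Matrix (Fin m) (Fin m) k).2 0 0 _
    = Matrix.fromBlocks 0 1 1 0 * Matrix.fromBlocks _ 0 0 _ * Matrix.fromBlocks 0 1 1 0
  simp [Matrix.fromBlocks_multiply]

lemma diagW_mem_normalizer (α : k) :
    diagW k m ∈ Subgroup.normalizer (twistedH k m α : Set (GL (Fin m ⊕ Fin m) k)) := by
  refine mem_normalizer_of_involution _ _ rfl ?_
  rintro _ ⟨A, rfl⟩
  refine ⟨Units.map (RingHom.toMonoidHom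
    (starRingEnd (QuadraticAlgebra k α 0)).mapMatrix) A, ?_⟩
  apply Units.ext
  change twistedEmb k m α ((starRingEnd (QuadraticAlgebra k α 0)).mapMatrix A.val)
    = Matrix.fromBlocks 1 0 0 (-1) * Matrix.fromBlocks _ _ _ _ * Matrix.fromBlocks 1 0 0 (-1)
  simp only [Matrix.fromBlocks_multiply]
  change Matrix.fromBlocks _ _ _ _ = _
  congr 1 <;> ext i j <;> simp [starRingEnd_apply]

end Models

end GJ

end

/-! In both cases there is a matrix `J` whose square is a non-zero scalar `α` (`diag(1,-1)` with `α
= 1`, respectively the image of `√α`) such that `ℋ` is the centralizer of `J` in the matrix algebra,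
`H` is its unit group and `w` anticommutes with `J`.

The Gauss sum operator `s⁻¹ ∑ ψ(tr g) π(g⁻¹)` commutes with `G`, so Schur's lemma
(`IsAbsolutelyIrreducible.exists_eq_smul`) makes it a scalar `c`, and
`functionalEquation_of_gaussSumOp` identifies `c` with the gamma factor. Apply an `H`-invariant form
`L` and split `G` into cosets `qH`: the inner sum is that of `ψ(tr(hq))` over `h ∈ H`. Cuspidality
lets `H` be enlarged to `ℋ`: the singular `A` with a given kernel `W ≠ 0` contribute nothing,
because `tr(Aq)` does not change when `q` is multiplied on the left by a unipotent radical moving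
vectors only along `W` (`sum_quotient_kerSum_eq_zero`). Over all of `ℋ`, orthogonality gives `|ℋ|`
if `q` anticommutes with `J`, that is `q ∈ wH`, and `0` otherwise (`sum_centralizer`). Since `s =
|ℋ|` and `w⁻¹ = w`, this reads `c L = L ∘ π(w)`, for every invariant `L` and without multiplicity
one.

Finally `N_G(H) = H ∪ wH` (`commute_or_anticommute_of_mem_normalizer`), so the whole normalizer acts
by scalars. -/

namespace GJ

/-! ### Schur's lemma over a field that need not be algebraically closed -/

section Schur

variable {R G V : Type*} [Field R] [Group G] [AddCommGroup V] [Module R V]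

/-- The finite orbit of a non-zero vector spans a non-zero subrepresentation. -/
theorem finiteDimensional_of_isIrreducible [Finite G] (π : Representation R G V)
    (hirr : π.IsIrreducible) : FiniteDimensional R V := by
  have hnt : Nontrivial (Subrepresentation π) := hirr.toNontrivial
  obtain ⟨v, hv⟩ : ∃ v : V, v ≠ 0 := by
    by_contra! h
    have : (⊥ : Subrepresentation π) = ⊤ := by
      apply Subrepresentation.toSubmodule_injective
      change (⊥ : Submodule R V) = ⊤
      exact (Submodule.eq_bot_iff _).2 (fun x _ => h x) |>.symm
    exact bot_ne_top this
  let S : Subrepresentation π :=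
    { toSubmodule := Submodule.span R (Set.range fun g => π g v)
      apply_mem_toSubmodule := by
        intro g x hx
        have : Submodule.span R (Set.range fun g => π g v) ≤
            (Submodule.span R (Set.range fun g => π g v)).comap (π g) := by
          rw [Submodule.span_le]
          rintro _ ⟨h, rfl⟩
          exact Submodule.subset_span ⟨g * h, by simp⟩
        exact this hx }
  have hmem : v ∈ S.toSubmodule := Submodule.subset_span ⟨1, by simp⟩
  rcases hirr.eq_bot_or_eq_top S with h | h
  · rw [h] at hmem
    exact absurd ((Submodule.mem_bot R).1 hmem) hv
  · have hS : Submodule.span R (Set.range fun g => π g v) = ⊤ :=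
      congrArg Subrepresentation.toSubmodule h
    exact ⟨(Submodule.fg_def).2 ⟨_, Set.finite_range _, hS⟩⟩

/-- Schur's lemma for absolutely irreducible representations of a finite group. -/
theorem IsAbsolutelyIrreducible.exists_eq_smul [Finite G] {π : Representation R G V}
    (hirr : IsAbsolutelyIrreducible π) (T : Module.End R V)
    (hT : ∀ g v, T (π g v) = π g (T v)) : ∃ c : R, ∀ v, T v = c • v := by
  let K := AlgebraicClosure R
  have hirr' : (extendScalars K π).IsIrreducible := hirr
  have hfd := finiteDimensional_of_isIrreducible _ hirr'
  let T' : Representation.IntertwiningMap (extendScalars K π) (extendScalars K π) :=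
    { toLinearMap := T.baseChange K
      isIntertwining' := by
        intro g
        apply TensorProduct.AlgebraTensorModule.ext
        intro x v
        change T.baseChange K ((π g).baseChange K (x ⊗ₜ[R] v)) =
          (π g).baseChange K (T.baseChange K (x ⊗ₜ[R] v))
        simp only [LinearMap.baseChange_tmul, hT] }
  obtain ⟨lam, hlam⟩ :=
    (Representation.IsIrreducible.algebraMap_intertwiningMap_bijective_of_isAlgClosed
      (ρ := extendScalars K π)).2 T'
  have key : ∀ v : V, (1 : K) ⊗ₜ[R] (T v) = lam • ((1 : K) ⊗ₜ[R] v) := by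
    intro v
    have h1 := congrArg (fun f => f ((1 : K) ⊗ₜ[R] v)) hlam
    exact h1.symm
  by_cases hV : ∀ v : V, v = 0
  · exact ⟨0, fun v => by rw [hV (T v), zero_smul]⟩
  push Not at hV
  obtain ⟨v₀, hv₀⟩ := hV
  obtain ⟨φ, hφ⟩ := Module.Projective.exists_dual_eq_one R hv₀
  -- The scalar `lam` exists a priori only in `K`; pairing with a form that takes the value `1` at
  -- `v₀` shows that it comes from `R`.
  refine ⟨φ (T v₀), fun v => ?_⟩
  have h2 : algebraMap R K (φ (T v₀)) = lam := by
    have h3 := congrArg (φ.baseChange K) (key v₀)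
    rw [map_smul] at h3
    simpa [Module.Dual.baseChange_apply_tmul, hφ, Algebra.algebraMap_eq_smul_one] using h3
  have hinj : Function.Injective (TensorProduct.mk R K V 1) :=
    Module.FaithfullyFlat.tensorProduct_mk_injective V
  apply hinj
  simp only [TensorProduct.mk_apply, key, ← h2, TensorProduct.tmul_smul, algebraMap_smul]

end Schur

/-! ### The characteristic of `k` is invertible in `R` -/

section Characters

variable {k : Type*} [Field k] [Fintype k] {R : Type*} [Field R]

/-- The values of `ψ` are `p`-th roots of unity, and in characteristic `p` the only one is `1`. -/
theorem natCast_ringChar_ne_zero {ψ : AddChar k R} (hψ : ψ ≠ 1) : ((ringChar k : ℕ) : R) ≠ 0 := by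
  intro h0
  have hp : (ringChar k).Prime := CharP.char_is_prime k (ringChar k)
  have : Fact (ringChar k).Prime := ⟨hp⟩
  have : CharP R (ringChar k) := (CharP.charP_iff_prime_eq_zero hp).2 h0
  apply hψ
  ext x
  have h1 : ψ x ^ ringChar k = 1 := by
    rw [← AddChar.map_nsmul_eq_pow, nsmul_eq_mul, ringChar.Nat.cast_ringChar, zero_mul,
      AddChar.map_zero_eq_one]
  have h2 : (ψ x - 1) ^ ringChar k = 0 := by
    rw [sub_pow_char, h1, one_pow, sub_self]
  rw [AddChar.one_apply]
  exact sub_eq_zero.1 (pow_eq_zero_iff hp.ne_zero |>.1 h2)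

end Characters

/-! ### The gamma factor as the eigenvalue of a Gauss sum operator -/

section FunctionalEquation

variable {k : Type*} [Field k] [Fintype k] [DecidableEq k]
variable {ι : Type*} [Fintype ι] [DecidableEq ι] {R : Type*} [Field R]
variable {V : Type*} [AddCommGroup V] [Module R V]

/-- The Gauss sum operator `s⁻¹ ∑_g ψ(tr g) π(g⁻¹)`. -/
noncomputable def gaussSumOp (ψ : AddChar k R) (s : R) (π : Representation R (GL ι k) V) :
    Module.End R V :=
  s⁻¹ • ∑ g : GL ι k, ψ (trace (g : Matrix ι ι k)) • π g⁻¹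

theorem gaussSumOp_apply (ψ : AddChar k R) (s : R) (π : Representation R (GL ι k) V) (v : V) :
    gaussSumOp ψ s π v = s⁻¹ • ∑ g : GL ι k, ψ (trace (g : Matrix ι ι k)) • π g⁻¹ v := by
  simp [gaussSumOp, LinearMap.sum_apply]

/-- The coefficient `ψ(tr g)` is a class function of `g`. -/
theorem gaussSumOp_comm (ψ : AddChar k R) (s : R) (π : Representation R (GL ι k) V)
    (x : GL ι k) (v : V) : gaussSumOp ψ s π (π x v) = π x (gaussSumOp ψ s π v) := by
  simp only [gaussSumOp_apply, map_smul, map_sum]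
  congr 1
  refine Fintype.sum_equiv (MulAut.conj x⁻¹).toEquiv _ _ fun g => ?_
  have h1 : trace (((MulAut.conj x⁻¹) g : GL ι k) : Matrix ι ι k) = trace (g : Matrix ι ι k) := by
    rw [MulAut.conj_apply, inv_inv, Units.val_mul, Units.val_mul, Matrix.trace_mul_cycle,
      Units.mul_inv, Matrix.one_mul]
  change _ = ψ (trace (((MulAut.conj x⁻¹) g : GL ι k) : Matrix ι ι k)) •
    π x (π ((MulAut.conj x⁻¹) g)⁻¹ v)
  rw [h1, ← Module.End.mul_apply, ← Module.End.mul_apply, ← map_mul, ← map_mul]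
  have h2 : x * ((MulAut.conj x⁻¹) g)⁻¹ = g⁻¹ * x := by
    rw [MulAut.conj_apply]
    group
  rw [h2]

/-- For fixed `x`, replacing `g` by `x⁻¹ g` turns the sum of `ψ(tr(x g)) π(g⁻¹) v` into the Gauss
sum operator applied to `π(x) v`. -/
theorem functionalEquation_of_gaussSumOp {ψ : AddChar k R} {s : R}
    {π : Representation R (GL ι k) V} {c : R} (hc : ∀ v, gaussSumOp ψ s π v = c • v) :
    FunctionalEquation ψ s π c := by
  intro Φ hΦ v L
  have hunits : ∀ F : Matrix ι ι k → R,
      ∑ x : Matrix ι ι k, Φ x * F x = ∑ x : GL ι k, Φ (x : Matrix ι ι k) * F x := by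
    intro F
    symm
    refine Finset.sum_of_injOn (fun x : GL ι k => (x : Matrix ι ι k))
      (fun a _ b _ h => Units.ext h) (fun _ _ => Finset.mem_coe.2 (Finset.mem_univ _)) ?_
      (fun _ _ => rfl)
    intro x _ hx
    rw [hΦ x, zero_mul]
    rintro ⟨u, rfl⟩
    exact hx ⟨u, by simp, rfl⟩
  have hop : ∀ x : GL ι k, s⁻¹ * ∑ g : GL ι k,
      ψ (trace ((x : Matrix ι ι k) * (g : Matrix ι ι k))) * L (π g⁻¹ v) = c * L (π x v) := by
    intro x
    have h1 := congrArg L (hc (π x v))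
    rw [gaussSumOp_apply] at h1
    simp only [map_smul, map_sum, smul_eq_mul] at h1
    rw [← h1]
    congr 1
    refine Fintype.sum_equiv (Equiv.mulLeft x) _ _ fun g => ?_
    rw [Equiv.coe_mulLeft, Units.val_mul, ← Module.End.mul_apply, ← map_mul]
    congr 4
    group
  simp only [zeta, fourier, matrixCoeff]
  have htrace : ∀ a : Matrix ι ι k, ∑ x : Matrix ι ι k, Φ x * ψ (trace (x * a)) =
      ∑ x : GL ι k, Φ (x : Matrix ι ι k) * ψ (trace ((x : Matrix ι ι k) * a)) :=
    fun a => hunits fun x => ψ (trace (x * a))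
  simp only [htrace]
  rw [Finset.mul_sum]
  have h2 : ∀ x : GL ι k, c * (Φ (x : Matrix ι ι k) * L (π x v)) = Φ (x : Matrix ι ι k) *
      (s⁻¹ * ∑ g : GL ι k,
        ψ (trace ((x : Matrix ι ι k) * (g : Matrix ι ι k))) * L (π g⁻¹ v)) := by
    intro x
    rw [hop x]
    ring
  simp only [h2, Finset.mul_sum, Finset.sum_mul]
  rw [Finset.sum_comm]
  refine Finset.sum_congr rfl fun x _ => Finset.sum_congr rfl fun g _ => ?_
  ring

open Classical in
theorem FunctionalEquation.unique {ψ : AddChar k R} {s : R}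
    {π : Representation R (GL ι k) V} [Nontrivial V] {c d : R}
    (hc : FunctionalEquation ψ s π c) (hd : FunctionalEquation ψ s π d) : c = d := by
  obtain ⟨v, hv⟩ := exists_ne (0 : V)
  obtain ⟨L, hL⟩ := Module.Projective.exists_dual_eq_one R hv
  -- The indicator of the identity isolates the value `L v = 1` of the matrix coefficient.
  let Φ : Matrix ι ι k → R := fun x => if x = 1 then 1 else 0
  have hΦ : ∀ x, ¬ IsUnit x → Φ x = 0 := by
    intro x hx
    refine if_neg ?_
    rintro rfl
    exact hx isUnit_one
  have hz : zeta Φ (matrixCoeff π v L) = 1 := by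
    rw [zeta, Finset.sum_eq_single 1]
    · simp [Φ, matrixCoeff, hL]
    · intro g _ hg
      have : (g : Matrix ι ι k) ≠ 1 := fun h => hg (Units.ext h)
      simp [Φ, this]
    · simp
  have h1 := hc Φ hΦ v L
  rw [hd Φ hΦ v L, hz, mul_one, mul_one] at h1
  exact h1.symm

theorem gammaFactor_eq {ψ : AddChar k R} {s : R} {π : Representation R (GL ι k) V} [Nontrivial V]
    {c : R} (hc : FunctionalEquation ψ s π c) : gammaFactor ψ s π = c := by
  have h : SatisfiesFunctionalEquation ψ s π := ⟨c, hc⟩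
  rw [gammaFactor, dif_pos h]
  exact h.choose_spec.unique hc

end FunctionalEquation

/-! ### The character of the normalizer on invariant forms -/

section PeriodCharacter

variable {R G V : Type*} [Field R] [Group G] [AddCommGroup V] [Module R V]

/-- If every element of the normalizer of `H` acts on the non-zero space of `H`-invariant forms by
a scalar, then these scalars form a character. -/
theorem exists_isPeriodCharacter {π : Representation R G V} {H : Subgroup G}
    (hdist : IsDistinguished π H)
    (hscal : ∀ n : Subgroup.normalizer (H : Set G), ∃ c : R, ∀ L ∈ invariantForms π H,
      L ∘ₗ π (n : G) = c • L) :
    ∃ χ : Subgroup.normalizer (H : Set G) →* Rˣ, IsPeriodCharacter π H χ := by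
  obtain ⟨L₀, hL₀, hne⟩ := (Submodule.ne_bot_iff _).1 hdist
  choose c hc using hscal
  -- A single non-zero form determines the scalars, which makes them multiplicative; being values on
  -- a group, they are then units.
  have huniq : ∀ a b : R, a • L₀ = b • L₀ → a = b := fun a b h => smul_left_injective R hne h
  let χ : Subgroup.normalizer (H : Set G) →* R :=
    { toFun := c
      map_one' := by
        apply huniq
        rw [← hc 1 L₀ hL₀]
        ext v
        simp
      map_mul' := by
        intro a b
        apply huniq
        rw [← hc (a * b) L₀ hL₀]
        have h1 : L₀ ∘ₗ π ((a * b : Subgroup.normalizer (H : Set G)) : G) =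
            (L₀ ∘ₗ π (a : G)) ∘ₗ π (b : G) := by
          ext v
          simp
        rw [h1, hc a L₀ hL₀, LinearMap.smul_comp, hc b L₀ hL₀, smul_smul] }
  exact ⟨χ.toHomUnits, fun n L hL => hc n L hL⟩

end PeriodCharacter

/-! ### Cuspidality as vanishing of sums over unipotent radicals -/

section Cuspidal

variable {k : Type*} [Field k] {ι : Type*} [Fintype ι] [DecidableEq ι]
variable {R V : Type*} [Field R] [AddCommGroup V] [Module R V]

/-- The flag `0 < W < k^ι`. -/
def Flag.ofSubmodule (W : Submodule k (ι → k)) (h0 : W ≠ ⊥) (h1 : W ≠ ⊤) : Flag k ι 2 where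
  space := ![⊥, W, ⊤]
  strictMono := by
    rw [Fin.strictMono_iff_lt_succ]
    intro i
    fin_cases i
    · exact bot_lt_iff_ne_bot.2 h0
    · exact lt_top_iff_ne_top.2 h1
  space_zero := rfl
  space_last := rfl

theorem Flag.mem_unipotentRadical_ofSubmodule {W : Submodule k (ι → k)} {h0 : W ≠ ⊥}
    {h1 : W ≠ ⊤} {g : GL ι k} : g ∈ (Flag.ofSubmodule W h0 h1).unipotentRadical ↔
      (∀ x ∈ W, (g : Matrix ι ι k) *ᵥ x = x) ∧ ∀ x, (g : Matrix ι ι k) *ᵥ x - x ∈ W := by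
  constructor
  · intro h
    refine ⟨fun x hx => ?_, fun x => h 1 x trivial⟩
    exact sub_eq_zero.1 ((Submodule.mem_bot k).1 (h 0 x hx))
  · rintro ⟨h2, h3⟩ i x hx
    fin_cases i
    · exact (Submodule.mem_bot k).2 (sub_eq_zero.2 (h2 x hx))
    · exact h3 x

/-- The sum over a finite group acting with zero coinvariants vanishes. -/
theorem sum_apply_eq_zero_of_subsingleton_coinvariants {U : Type*} [Group U] [Fintype U]
    (ρ : Representation R U V) (h : Subsingleton ρ.Coinvariants) (v : V) :
    ∑ u : U, ρ u v = 0 := by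
  -- This sum is invariant under `U`, so it factors through the zero space of coinvariants.
  let N : V →ₗ[R] V := ∑ u : U, ρ u
  have hN : ∀ x, N x = ∑ u : U, ρ u x := fun x => by simp [N, LinearMap.sum_apply]
  have hinv : ∀ x : U, N ∘ₗ ρ x = N := by
    intro x
    ext v
    simp only [LinearMap.comp_apply, hN, ← Module.End.mul_apply, ← map_mul]
    exact Fintype.sum_equiv (Equiv.mulRight x) _ _ fun _ => rfl
  rw [← hN, ← Representation.Coinvariants.lift_mk ρ N hinv v,
    Subsingleton.elim (Representation.Coinvariants.mk ρ v) 0, map_zero]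

/-- Here `(g - 1)² = 0`, so `gⁿ = 1 + n (g - 1)`. -/
theorem pow_ringChar_eq_one_of_mem_unipotentRadical [Fintype k] {W : Submodule k (ι → k)}
    {h0 : W ≠ ⊥} {h1 : W ≠ ⊤} {g : GL ι k}
    (hg : g ∈ (Flag.ofSubmodule W h0 h1).unipotentRadical) : g ^ ringChar k = 1 := by
  rw [Flag.mem_unipotentRadical_ofSubmodule] at hg
  have hpow : ∀ (n : ℕ) (x : ι → k),
      ((g ^ n : GL ι k) : Matrix ι ι k) *ᵥ x = x + n • ((g : Matrix ι ι k) *ᵥ x - x) := by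
    intro n
    induction n with
    | zero => simp
    | succ n ih =>
      intro x
      have h := hg.1 _ (hg.2 x)
      rw [Matrix.mulVec_sub] at h
      rw [pow_succ, Units.val_mul, ← Matrix.mulVec_mulVec, ih, h, succ_nsmul]
      abel
  apply Units.ext
  apply Matrix.ext_of_mulVec_single
  intro i
  rw [hpow, ← Nat.cast_smul_eq_nsmul k, ringChar.Nat.cast_ringChar, zero_smul, add_zero,
    Units.val_one, Matrix.one_mulVec]

open Classical in
/-- For a cuspidal representation, every non-zero subspace `W` admits a subgroup of elements moving
vectors only along `W`, over which sums in the representation vanish, and whose order is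
invertible in `R`. -/
theorem IsCuspidal.exists_subgroup [Fintype k] [DecidableEq k] [Nontrivial ι] {ψ : AddChar k R} (hψ : ψ ≠ 1)
    {π : Representation R (GL ι k) V} (hcusp : IsCuspidal π) (W : Submodule k (ι → k))
    (hW : W ≠ ⊥) : ∃ U : Subgroup (GL ι k), ((Fintype.card U : ℕ) : R) ≠ 0 ∧
      (∀ u ∈ U, ∀ x, (u : Matrix ι ι k) *ᵥ x - x ∈ W) ∧ ∀ v, ∑ u : U, π u v = 0 := by
  -- A line inside `W` replaces `W`, which may be the whole space (the kernel of `A = 0`); a line is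
  -- always proper, as `ι` has more than one element.
  obtain ⟨y, hy, hy0⟩ := (Submodule.ne_bot_iff W).1 hW
  have h0 : Submodule.span k {y} ≠ ⊥ := by simpa using hy0
  have h1 : Submodule.span k {y} ≠ ⊤ := by
    intro h
    have h2 := finrank_span_singleton (K := k) hy0
    rw [h, finrank_top, Module.finrank_fintype_fun_eq_card] at h2
    have := Fintype.one_lt_card (α := ι)
    omega
  refine ⟨(Flag.ofSubmodule _ h0 h1).unipotentRadical, ?_, ?_, ?_⟩
  · have : Fact (ringChar k).Prime := ⟨CharP.char_is_prime k (ringChar k)⟩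
    have hp : IsPGroup (ringChar k) (Flag.ofSubmodule _ h0 h1).unipotentRadical := by
      rintro ⟨g, hg⟩
      refine ⟨1, Subtype.ext ?_⟩
      simpa using pow_ringChar_eq_one_of_mem_unipotentRadical hg
    obtain ⟨n, hn⟩ := IsPGroup.iff_card.1 hp
    rw [← Nat.card_eq_fintype_card, hn, Nat.cast_pow]
    exact pow_ne_zero _ (natCast_ringChar_ne_zero hψ)
  · intro u hu x
    exact (Submodule.span_singleton_le_iff_mem y W).2 hy
      ((Flag.mem_unipotentRadical_ofSubmodule.1 hu).2 x)
  · exact fun v => sum_apply_eq_zero_of_subsingleton_coinvariants _ (hcusp 2 le_rfl _) v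

end Cuspidal

/-! ### Sums over cosets -/

section Cosets

variable {G : Type*} [Group G] [Fintype G] {R : Type*} [Field R] (H : Subgroup G)

open Classical in
theorem sum_eq_sum_quotient_sum (F : G → R) :
    ∑ g, F g = ∑ q : G ⧸ H, ∑ h : H, F (q.out * h) := by
  rw [← Finset.sum_product', Finset.univ_product_univ]
  symm
  refine Fintype.sum_bijective (fun x : (G ⧸ H) × H => x.1.out * (x.2 : G)) ?_ _ _ fun _ => rfl
  constructor
  · rintro ⟨q, h⟩ ⟨q', h'⟩ he
    have hq : q = q' := by
      have h1 := congrArg (QuotientGroup.mk (s := H)) he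
      simpa using h1
    subst hq
    simpa using he
  · intro g
    refine ⟨(g, ⟨((g : G ⧸ H).out)⁻¹ * g, ?_⟩), by simp⟩
    exact QuotientGroup.eq.1 (by simp)

open Classical in
theorem sum_quotient_mul_left {F : G → R} (hF : ∀ g, ∀ h ∈ H, F (g * h) = F g) (u : G) :
    ∑ q : G ⧸ H, F (u * q.out) = ∑ q : G ⧸ H, F q.out := by
  have hout : ∀ g : G, F ((g : G ⧸ H).out) = F g := by
    intro g
    obtain ⟨h, hh⟩ := QuotientGroup.mk_out_eq_mul H g
    rw [hh, hF _ _ h.2]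
  refine Fintype.sum_equiv (MulAction.toPerm u) _ _ fun q => ?_
  conv_rhs => rw [← QuotientGroup.out_eq' q]
  rw [← hout]
  rfl

open Classical in
/-- A sum over `G ⧸ H` vanishes if the sums over the orbits of a subgroup vanish. -/
theorem sum_quotient_eq_zero {F : G → R} (hF : ∀ g, ∀ h ∈ H, F (g * h) = F g) (U : Subgroup G)
    (hU : ((Fintype.card U : ℕ) : R) ≠ 0) (hsum : ∀ g, ∑ u : U, F (u * g) = 0) :
    ∑ q : G ⧸ H, F q.out = 0 := by
  -- This double sum is also `|U|` times the sum over cosets, so nothing is needed about the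
  -- stabilizers of `U` on `G ⧸ H`.
  have h1 : ∑ u : U, ∑ q : G ⧸ H, F (u * q.out) = 0 := by
    rw [Finset.sum_comm]
    exact Finset.sum_eq_zero fun q _ => hsum _
  simp only [sum_quotient_mul_left H hF] at h1
  rw [Finset.sum_const, nsmul_eq_mul] at h1
  exact (mul_eq_zero.1 h1).resolve_left hU

end Cosets

/-! ### The normalizer of the centralizer of `J` -/

section Normalizer

variable {k : Type*} [Field k] {ι : Type*} [Fintype ι] [DecidableEq ι]

/-- An invertible `K` with `K² = J² = α` lying in the centralizer of `J` and commuting with all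
invertible elements of that centralizer is `±J` or scalar. -/
theorem eq_or_eq_neg_or_scalar {J K : Matrix ι ι k} {α : k} (h2 : (2 : k) ≠ 0) (hα : α ≠ 0)
    (hJ : J * J = α • 1) (hK : K * K = α • 1) (hJK : J * K = K * J)
    (hcomm : ∀ g : GL ι k, (g : Matrix ι ι k) * J = J * g → K * (g : Matrix ι ι k) = g * K) :
    K = J ∨ K = -J ∨ ∃ c : k, K = c • 1 := by
  -- `E` is an involution with `K = E J`; below, `e` and `f` are twice its complementary
  -- idempotents, and the cases `K = -J` and `K = J` are `e = 0` and `f = 0`.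
  set E : Matrix ι ι k := α⁻¹ • (K * J) with hE
  have hEE : E * E = 1 := by
    rw [hE, smul_mul_smul_comm, Matrix.mul_assoc, ← Matrix.mul_assoc J, hJK, Matrix.mul_assoc K J J,
      hJ, Matrix.mul_smul, Matrix.mul_smul, Matrix.mul_one, hK, smul_smul, smul_smul]
    field_simp
    simp
  have hEJ : E * J = K := by
    rw [hE, Matrix.smul_mul, Matrix.mul_assoc, hJ, Matrix.mul_smul, smul_smul, Matrix.mul_one,
      inv_mul_cancel₀ hα, one_smul]
  have hJE : J * E = K := by
    rw [hE, Matrix.mul_smul, ← Matrix.mul_assoc, hJK, Matrix.mul_assoc, hJ, Matrix.mul_smul,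
      smul_smul, Matrix.mul_one, inv_mul_cancel₀ hα, one_smul]
  set e : Matrix ι ι k := 1 + E with he
  set f : Matrix ι ι k := 1 - E with hf
  have hEe : E * e = e := by rw [he, mul_add, hEE, mul_one, add_comm]
  have hfE : f * E = -f := by rw [hf, sub_mul, hEE, one_mul, neg_sub]
  have hfe : f * e = 0 := by rw [hf, sub_mul, hEe, one_mul, sub_self]
  have heJ : e * J = J * e := by rw [he, add_mul, mul_add, hEJ, hJE, one_mul, mul_one]
  have hfJ : f * J = J * f := by rw [hf, sub_mul, mul_sub, hEJ, hJE, one_mul, mul_one]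
  -- `B` has square zero and commutes with `J`, so `1 + B` is an invertible test element. Hence `E`
  -- commutes with `B`, whereas `E B = B` and `B E = -B`; therefore `B = 0`.
  have hB : ∀ X : Matrix ι ι k, (e * J) * X * f = -(e * X * (J * f)) := by
    intro X
    set B : Matrix ι ι k := e * (J * X + X * J) * f with hBdef
    have hBB : B * B = 0 := by
      rw [hBdef, Matrix.mul_assoc _ f, ← Matrix.mul_assoc f, ← Matrix.mul_assoc f, hfe,
        Matrix.zero_mul, Matrix.zero_mul, Matrix.mul_zero]
    have hXJ : (J * X + X * J) * J = J * (J * X + X * J) := by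
      rw [add_mul, mul_add, ← Matrix.mul_assoc J J, hJ, Matrix.mul_assoc X, hJ]
      simp [Matrix.mul_assoc, add_comm]
    have hBJ : B * J = J * B := by
      rw [hBdef, Matrix.mul_assoc, hfJ, ← Matrix.mul_assoc, Matrix.mul_assoc e, hXJ,
        ← Matrix.mul_assoc e, heJ]
      simp only [Matrix.mul_assoc]
    let g : GL ι k := ⟨1 + B, 1 - B, by rw [add_mul, mul_sub, mul_sub, hBB]; simp,
      by rw [sub_mul, mul_add, mul_add, hBB]; simp⟩
    have hKg := hcomm g (by
      change (1 + B) * J = J * (1 + B)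
      rw [add_mul, mul_add, hBJ, one_mul, mul_one])
    have hKB : K * B = B * K := by
      change K * (1 + B) = (1 + B) * K at hKg
      rw [add_mul, mul_add, one_mul, mul_one] at hKg
      exact add_left_cancel hKg
    have hEB : E * B = B * E := by
      rw [hE, Matrix.smul_mul, Matrix.mul_smul, Matrix.mul_assoc, ← hBJ, ← Matrix.mul_assoc, hKB,
        Matrix.mul_assoc]
    have h3 : E * B = B := by
      rw [hBdef, ← Matrix.mul_assoc, ← Matrix.mul_assoc, hEe]
    have h4 : B * E = -B := by
      rw [hBdef, Matrix.mul_assoc, hfE, Matrix.mul_neg]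
    rw [h3, h4] at hEB
    have h5 : (2 : k) • B = 0 := by
      rw [two_smul]
      nth_rewrite 1 [hEB]
      exact neg_add_cancel B
    have h6 : B = 0 := (smul_eq_zero.1 h5).resolve_left h2
    rw [hBdef, mul_add, add_mul] at h6
    simp only [Matrix.mul_assoc] at h6 ⊢
    exact eq_neg_of_add_eq_zero_left h6
  by_cases he0 : e = 0
  · right; left
    rw [← hEJ, eq_neg_of_add_eq_zero_right he0, neg_mul, one_mul]
  by_cases hf0 : f = 0
  · left
    rw [← hEJ, ← sub_eq_zero.1 hf0, one_mul]
  right; right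
  -- Taking matrix units for `X` separates the two factors: a non-zero entry of each of `e` and `f`
  -- then forces `e J = c e` and `J f = -c f` with the same `c`.
  have hent : ∀ a i j b, (e * J) a i * f j b = -(e a i * (J * f) j b) := by
    intro a i j b
    have h := congrFun (congrFun (hB (Matrix.single i j 1)) a) b
    rw [Matrix.neg_apply] at h
    generalize e * J = M at h ⊢
    generalize J * f = N at h ⊢
    rw [Matrix.mul_assoc, Matrix.mul_assoc] at h
    simpa [Matrix.mul_apply, Matrix.single_apply, Finset.sum_ite_eq, ite_and] using h
  obtain ⟨j₀, b₀, hjb⟩ : ∃ j b, f j b ≠ 0 := by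
    by_contra! h
    exact hf0 (Matrix.ext h)
  obtain ⟨a₀, i₀, hai⟩ : ∃ a i, e a i ≠ 0 := by
    by_contra! h
    exact he0 (Matrix.ext h)
  set c : k := -(J * f) j₀ b₀ / f j₀ b₀ with hc
  have hec : e * J = c • e := by
    ext a i
    rw [Matrix.smul_apply, smul_eq_mul, hc]
    field_simp
    linear_combination hent a i j₀ b₀
  have hfc : J * f = -(c • f) := by
    ext j b
    rw [Matrix.neg_apply, Matrix.smul_apply, smul_eq_mul]
    have h := hent a₀ i₀ j b
    rw [hec, Matrix.smul_apply, smul_eq_mul] at h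
    apply mul_left_cancel₀ hai
    linear_combination h
  refine ⟨c, ?_⟩
  have h7 : (2 : k) • K = (2 : k) • (c • (1 : Matrix ι ι k)) := by
    have h8 : e * J - f * J = (2 : k) • K := by
      rw [he, hf, add_mul, sub_mul, hEJ, two_smul]
      abel
    rw [← h8, hfJ, hec, hfc, he, hf, two_smul]
    simp only [smul_add, smul_sub]
    abel
  exact smul_right_injective _ h2 h7

/-- Elements of the normalizer of the centralizer of `J` commute or anticommute with `J`. -/
theorem commute_or_anticommute_of_mem_normalizer {J : Matrix ι ι k} {α : k} (h2 : (2 : k) ≠ 0)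
    (hα : α ≠ 0) (hJ : J * J = α • 1) (hJs : ∀ c : k, J ≠ c • 1) {H : Subgroup (GL ι k)}
    (hH : ∀ g : GL ι k, g ∈ H ↔ (g : Matrix ι ι k) * J = J * g) {n : GL ι k}
    (hn : n ∈ Subgroup.normalizer (H : Set (GL ι k))) :
    (n : Matrix ι ι k) * J = J * n ∨ (n : Matrix ι ι k) * J = -(J * n) := by
  rw [Subgroup.mem_normalizer_iff] at hn
  let j : GL ι k := ⟨J, α⁻¹ • J,
    by rw [Matrix.mul_smul, hJ, smul_smul, inv_mul_cancel₀ hα, one_smul],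
    by rw [Matrix.smul_mul, hJ, smul_smul, inv_mul_cancel₀ hα, one_smul]⟩
  have hj : j ∈ H := (hH j).2 rfl
  have hjc : ∀ h ∈ H, j * h = h * j := fun h hh => Units.ext ((hH h).1 hh).symm
  -- Conjugation by `n` preserves `H`, hence also its centre, which contains `j`.
  let K := n * j * n⁻¹
  have hKH : K ∈ H := (hn j).1 hj
  have hKc : ∀ h ∈ H, K * h = h * K := by
    intro h hh
    have h3 : n⁻¹ * h * n ∈ H := (hn _).2 (by simpa [mul_assoc] using hh)
    have h4 := hjc _ h3
    calc K * h = n * (j * (n⁻¹ * h * n)) * n⁻¹ := by simp only [K]; group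
      _ = h * K := by rw [h4]; simp only [K]; group
  have hKK : (K : Matrix ι ι k) * K = α • 1 := by
    have h5 : K * K = n * (j * j) * n⁻¹ := by simp only [K]; group
    have h6 := congrArg Units.val h5
    simp only [Units.val_mul] at h6 ⊢
    rw [h6]
    change (n : Matrix ι ι k) * (J * J) * _ = _
    rw [hJ, Matrix.mul_smul, Matrix.mul_one, Matrix.smul_mul, Units.mul_inv]
  have hKn : K * n = n * j := by simp only [K]; group
  have hKn' : (K : Matrix ι ι k) * n = n * J := congrArg Units.val hKn
  rcases eq_or_eq_neg_or_scalar h2 hα hJ hKK (congrArg Units.val (hjc K hKH))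
    (fun g hg => congrArg Units.val (hKc g ((hH g).2 hg))) with h | h | ⟨c, h⟩
  · left
    rw [← hKn', h]
  · right
    rw [← hKn', h, Matrix.neg_mul]
  · exfalso
    apply hJs c
    have h9 : n * (n⁻¹ * K * n) = n * j := by rw [← hKn]; group
    have h10 : n⁻¹ * K * n = j := mul_left_cancel h9
    have h11 : ((n⁻¹ : GL ι k) : Matrix ι ι k) * K * n = J := congrArg Units.val h10
    rw [← h11, h, Matrix.mul_smul, Matrix.mul_one, Matrix.smul_mul, Units.inv_mul]

end Normalizer

/-! ### Orthogonality of characters on the centralizer of `J` -/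

section Centralizer

variable {k : Type*} [Field k] {ι : Type*} [Fintype ι] [DecidableEq ι]

/-- Moving one factor `J` of `A g J²` around the trace changes the sign, while `J²` is a non-zero
scalar and `2 ≠ 0`. -/
theorem trace_mul_eq_zero_of_anticommute {J g A : Matrix ι ι k} {α : k} (h2 : (2 : k) ≠ 0)
    (hα : α ≠ 0) (hJ : J * J = α • 1) (hg : g * J = -(J * g)) (hA : A * J = J * A) :
    trace (A * g) = 0 := by
  have h1 : trace (A * g * (J * J)) = α * trace (A * g) := by
    rw [hJ, Matrix.mul_smul, Matrix.mul_one, trace_smul, smul_eq_mul]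
  have h3 : trace (A * g * (J * J)) = -(α * trace (A * g)) := by
    rw [← Matrix.mul_assoc, Matrix.mul_assoc A, hg, Matrix.mul_neg, Matrix.neg_mul, trace_neg,
      ← Matrix.mul_assoc A, hA, Matrix.trace_mul_comm, Matrix.mul_assoc J A, ← Matrix.mul_assoc J J,
      hJ, Matrix.smul_mul, Matrix.one_mul, trace_smul, smul_eq_mul]
  have h4 : (2 * α) * trace (A * g) = 0 := by linear_combination h3 - h1
  exact (mul_eq_zero.1 h4).resolve_left (mul_ne_zero h2 hα)

/-- The matrices `J X + X J` commute with `J` and give `tr(X (g J + J g)) = 0` for all `X`; the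
trace form is nondegenerate. -/
theorem anticommute_of_trace_mul_eq_zero {J g : Matrix ι ι k} {α : k} (hJ : J * J = α • 1)
    (htr : ∀ A : Matrix ι ι k, A * J = J * A → trace (A * g) = 0) : g * J = -(J * g) := by
  apply eq_neg_of_add_eq_zero_left
  rw [Matrix.ext_iff_trace_mul_left]
  intro X
  have hX : (J * X + X * J) * J = J * (J * X + X * J) := by
    rw [add_mul, mul_add, ← Matrix.mul_assoc J J, hJ, Matrix.mul_assoc X, hJ]
    simp [Matrix.mul_assoc, add_comm]
  have h := htr _ hX
  rw [add_mul, trace_add, Matrix.mul_assoc J, Matrix.trace_mul_comm J] at h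
  rw [mul_add, trace_add, Matrix.mul_zero, trace_zero]
  simpa [Matrix.mul_assoc] using h

open Classical in
/-- Orthogonality: the sum of `ψ(tr(A g))` over the centralizer of `J`. -/
theorem sum_centralizer [Fintype k] [DecidableEq k] {R : Type*} [Field R] {ψ : AddChar k R} (hψ : ψ ≠ 1) {J : Matrix ι ι k} {α : k}
    (h2 : (2 : k) ≠ 0) (hα : α ≠ 0) (hJ : J * J = α • 1) (g : Matrix ι ι k) :
    ∑ A : Matrix ι ι k with A * J = J * A, ψ (trace (A * g)) =
      if g * J = -(J * g) then ((Nat.card {A : Matrix ι ι k // A * J = J * A} : ℕ) : R) else 0 := by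
  split_ifs with hg
  · rw [Finset.sum_congr rfl (g := fun _ => (1 : R)), Finset.sum_const, nsmul_one,
      Nat.card_eq_fintype_card, Fintype.card_subtype]
    intro A hA
    rw [trace_mul_eq_zero_of_anticommute h2 hα hJ hg (Finset.mem_filter.1 hA).2,
      AddChar.map_zero_eq_one]
  · obtain ⟨A₀, hA₀, htr⟩ : ∃ A : Matrix ι ι k, A * J = J * A ∧ trace (A * g) ≠ 0 := by
      by_contra! h
      exact hg (anticommute_of_trace_mul_eq_zero hJ h)
    obtain ⟨t, ht⟩ := (AddChar.ne_one_iff).1 hψ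
    -- Translation by `B` permutes the centralizer and multiplies the sum by `ψ t ≠ 1`.
    set B := (t / trace (A₀ * g)) • A₀ with hBdef
    have hB : B * J = J * B := by rw [hBdef, Matrix.smul_mul, Matrix.mul_smul, hA₀]
    have hBt : trace (B * g) = t := by
      rw [hBdef, Matrix.smul_mul, trace_smul, smul_eq_mul, div_mul_cancel₀ _ htr]
    have key : ∑ A : Matrix ι ι k with A * J = J * A, ψ (trace (A * g)) =
        ψ t * ∑ A : Matrix ι ι k with A * J = J * A, ψ (trace (A * g)) := by
      rw [Finset.mul_sum]
      symm
      refine Finset.sum_bij (fun A _ => B + A) ?_ (fun _ _ _ _ h => add_left_cancel h) ?_ ?_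
      · intro A hA
        refine Finset.mem_filter.2 ⟨Finset.mem_univ _, ?_⟩
        rw [add_mul, mul_add, hB, (Finset.mem_filter.1 hA).2]
      · intro A hA
        refine ⟨A - B, Finset.mem_filter.2 ⟨Finset.mem_univ _, ?_⟩, by simp⟩
        rw [sub_mul, mul_sub, hB, (Finset.mem_filter.1 hA).2]
      · intro A _
        rw [add_mul, trace_add, hBt, AddChar.map_add_eq_mul]
    have h3 : (ψ t - 1) * ∑ A : Matrix ι ι k with A * J = J * A, ψ (trace (A * g)) = 0 := by
      linear_combination -key
    exact (mul_eq_zero.1 h3).resolve_left (sub_ne_zero.2 ht)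

theorem ker_mulVecLin_mul_left (h : GL ι k) (A : Matrix ι ι k) :
    LinearMap.ker ((h : Matrix ι ι k) * A).mulVecLin = LinearMap.ker A.mulVecLin := by
  have hinj : Function.Injective ((h : Matrix ι ι k) *ᵥ ·) :=
    Matrix.mulVec_injective_iff_isUnit.2 h.isUnit
  ext x
  rw [LinearMap.mem_ker, LinearMap.mem_ker, Matrix.mulVecLin_apply, Matrix.mulVecLin_apply,
    ← Matrix.mulVec_mulVec]
  exact ⟨fun hx => hinj (hx.trans (Matrix.mulVec_zero _).symm),
    fun hx => by rw [hx, Matrix.mulVec_zero]⟩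

/-- The centralizer is an additive `p`-group, and `p` is invertible in `R`. -/
theorem card_centralizer_ne_zero [Fintype k] {R : Type*} [Field R] {ψ : AddChar k R} (hψ : ψ ≠ 1) (J : Matrix ι ι k) :
    ((Nat.card {A : Matrix ι ι k // A * J = J * A} : ℕ) : R) ≠ 0 := by
  have : Fact (ringChar k).Prime := ⟨CharP.char_is_prime k (ringChar k)⟩
  let S : AddSubgroup (Matrix ι ι k) :=
    { carrier := {A | A * J = J * A}
      add_mem' := fun {A B} hA hB => by
        change (A + B) * J = J * (A + B)
        rw [add_mul, mul_add, hA, hB]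
      zero_mem' := by simp
      neg_mem' := fun {A} hA => by
        change -A * J = J * -A
        rw [Matrix.neg_mul, Matrix.mul_neg, hA] }
  have hp : IsPGroup (ringChar k) (Multiplicative S) := by
    intro A
    refine ⟨1, ?_⟩
    apply Multiplicative.toAdd.injective
    rw [pow_one, toAdd_pow, toAdd_one]
    apply Subtype.ext
    ext i j
    simp [nsmul_eq_mul, Matrix.smul_apply]
  obtain ⟨n, hn⟩ := IsPGroup.iff_card.1 hp
  change ((Nat.card (Multiplicative S) : ℕ) : R) ≠ 0
  rw [hn, Nat.cast_pow]
  exact pow_ne_zero _ (natCast_ringChar_ne_zero hψ)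

end Centralizer

/-! ### The period of the Gauss sum and the theorem for general `J` -/

section Distinguished

variable {k : Type*} [Field k] [Fintype k] [DecidableEq k]
variable {ι : Type*} [Fintype ι] [DecidableEq ι] {R : Type*} [Field R]
variable {V : Type*} [AddCommGroup V] [Module R V]

open Classical in
/-- The sum of `ψ(tr(A g))` over the `A` with kernel `W` in the centralizer of `J`. -/
noncomputable def kerSum (ψ : AddChar k R) (J : Matrix ι ι k) (W : Submodule k (ι → k))
    (g : Matrix ι ι k) : R :=
  ∑ A : Matrix ι ι k with A * J = J * A ∧ LinearMap.ker A.mulVecLin = W, ψ (trace (A * g))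

/-- `tr(A g h) = tr(h A g)`, and `A ↦ h A` preserves both the centralizer and the kernel. -/
theorem kerSum_mul_right (ψ : AddChar k R) {J : Matrix ι ι k} (W : Submodule k (ι → k))
    (g : Matrix ι ι k) {h : GL ι k} (hh : (h : Matrix ι ι k) * J = J * h)
    (hh' : ((h⁻¹ : GL ι k) : Matrix ι ι k) * J = J * (h⁻¹ : GL ι k)) :
    kerSum ψ J W (g * h) = kerSum ψ J W g := by
  classical
  have hmem : ∀ (x : GL ι k) (A : Matrix ι ι k), (x : Matrix ι ι k) * J = J * x →
      A * J = J * A ∧ LinearMap.ker A.mulVecLin = W →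
      ((x : Matrix ι ι k) * A) * J = J * (x * A) ∧
        LinearMap.ker ((x : Matrix ι ι k) * A).mulVecLin = W := by
    intro x A hx hA
    refine ⟨?_, (ker_mulVecLin_mul_left x A).trans hA.2⟩
    rw [Matrix.mul_assoc, hA.1, ← Matrix.mul_assoc, hx, Matrix.mul_assoc]
  refine Finset.sum_bij' (fun A _ => (h : Matrix ι ι k) * A)
    (fun A _ => ((h⁻¹ : GL ι k) : Matrix ι ι k) * A) ?_ ?_ ?_ ?_ ?_
  · exact fun A hA => Finset.mem_filter.2
      ⟨Finset.mem_univ _, hmem h A hh (Finset.mem_filter.1 hA).2⟩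
  · exact fun A hA => Finset.mem_filter.2
      ⟨Finset.mem_univ _, hmem h⁻¹ A hh' (Finset.mem_filter.1 hA).2⟩
  · intro A _
    rw [← Matrix.mul_assoc, Units.inv_mul, Matrix.one_mul]
  · intro A _
    rw [← Matrix.mul_assoc, Units.mul_inv, Matrix.one_mul]
  · intro A _
    rw [← Matrix.mul_assoc, Matrix.trace_mul_comm, ← Matrix.mul_assoc]

/-- `A` kills the image of `u - 1`, so `A u = A`. -/
theorem kerSum_mul_left (ψ : AddChar k R) {J : Matrix ι ι k} {W : Submodule k (ι → k)}
    (g : Matrix ι ι k) {u : Matrix ι ι k} (hu : ∀ x, u *ᵥ x - x ∈ W) :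
    kerSum ψ J W (u * g) = kerSum ψ J W g := by
  classical
  refine Finset.sum_congr rfl fun A hA => ?_
  have h2 := (Finset.mem_filter.1 hA).2.2
  have hAu : A * u = A := by
    apply Matrix.ext_of_mulVec_single
    intro i
    have h3 := hu (Pi.single i 1)
    rw [← h2, LinearMap.mem_ker, Matrix.mulVecLin_apply, Matrix.mulVec_sub,
      Matrix.mulVec_mulVec] at h3
    exact sub_eq_zero.1 h3
  rw [← Matrix.mul_assoc, hAu]

open Classical in
/-- For a cuspidal representation, the elements of the centralizer of `J` with a fixed non-zero
kernel do not contribute to the period of the Gauss sum. -/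
theorem sum_quotient_kerSum_eq_zero [Nontrivial ι] {ψ : AddChar k R} (hψ : ψ ≠ 1)
    {π : Representation R (GL ι k) V} (hcusp : IsCuspidal π) {J : Matrix ι ι k}
    {H : Subgroup (GL ι k)} (hH : ∀ g : GL ι k, g ∈ H ↔ (g : Matrix ι ι k) * J = J * g)
    {L : Module.Dual R V} (hL : L ∈ invariantForms π H) (v : V) (W : Submodule k (ι → k))
    (hW : W ≠ ⊥) :
    ∑ q : GL ι k ⧸ H, kerSum ψ J W (q.out : GL ι k) * L (π q.out⁻¹ v) = 0 := by
  obtain ⟨U, hU, hUW, hsum⟩ := hcusp.exists_subgroup hψ W hW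
  refine sum_quotient_eq_zero H (F := fun g => kerSum ψ J W g * L (π g⁻¹ v)) ?_ U hU ?_
  · intro g h hh
    rw [Units.val_mul, kerSum_mul_right ψ W g ((hH h).1 hh) ((hH _).1 (H.inv_mem hh)),
      _root_.mul_inv_rev, map_mul, Module.End.mul_apply, hL _ (H.inv_mem hh)]
  · intro g
    -- The kernel sum is constant along the orbit of `U`, leaving the sum of `π u v` over `U`, which
    -- vanishes by cuspidality.
    have h1 : ∀ u : U, kerSum ψ J W ((u * g : GL ι k) : Matrix ι ι k) * L (π (u * g)⁻¹ v) =
        kerSum ψ J W g * L (π g⁻¹ (π (u⁻¹ : U) v)) := by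
      intro u
      rw [Units.val_mul, kerSum_mul_left ψ _ (hUW u u.2), _root_.mul_inv_rev, map_mul,
        Module.End.mul_apply, Subgroup.coe_inv]
    simp only [h1]
    rw [← Finset.mul_sum, ← map_sum, ← map_sum,
      Fintype.sum_equiv (Equiv.inv U) (fun u : U => π (u⁻¹ : U) v) (fun u : U => π u v)
        (fun _ => rfl), hsum, map_zero, map_zero, mul_zero]

-- `H` is the stratum `W = ⊥` in the partition of the centralizer algebra by kernels.
open Classical in
theorem sum_subgroup_eq_sum_ker_bot {J : Matrix ι ι k}
    {H : Subgroup (GL ι k)} (hH : ∀ g : GL ι k, g ∈ H ↔ (g : Matrix ι ι k) * J = J * g)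
    (F : Matrix ι ι k → R) :
    ∑ h : H, F ((h : GL ι k) : Matrix ι ι k) =
      ∑ A : Matrix ι ι k with A * J = J * A ∧ LinearMap.ker A.mulVecLin = ⊥, F A := by
  refine Finset.sum_bij (fun h _ => ((h : GL ι k) : Matrix ι ι k)) ?_ ?_ ?_ fun _ _ => rfl
  · intro h _
    refine Finset.mem_filter.2 ⟨Finset.mem_univ _, (hH h).1 h.2, ?_⟩
    rw [LinearMap.ker_eq_bot]
    exact Matrix.mulVec_injective_iff_isUnit.2 (Units.isUnit (h : GL ι k))
  · intro a _ b _ hab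
    exact Subtype.ext (Units.ext hab)
  · intro A hA
    obtain ⟨-, h1, h2⟩ := Finset.mem_filter.1 hA
    rw [LinearMap.ker_eq_bot] at h2
    obtain ⟨u, rfl⟩ := Matrix.mulVec_injective_iff_isUnit.1 h2
    exact ⟨⟨u, (hH u).2 h1⟩, Finset.mem_univ _, rfl⟩

open Classical in
/-- The period of the Gauss sum of a cuspidal representation. -/
theorem sum_trace_mul_invariantForm [Nontrivial ι] {ψ : AddChar k R} (hψ : ψ ≠ 1)
    {π : Representation R (GL ι k) V} (hcusp : IsCuspidal π) {J : Matrix ι ι k} {α : k}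
    (h2 : (2 : k) ≠ 0) (hα : α ≠ 0) (hJ : J * J = α • 1)
    {H : Subgroup (GL ι k)} (hH : ∀ g : GL ι k, g ∈ H ↔ (g : Matrix ι ι k) * J = J * g)
    {w : GL ι k} (hw : (w : Matrix ι ι k) * J = -(J * w))
    {L : Module.Dual R V} (hL : L ∈ invariantForms π H) (v : V) :
    ∑ g : GL ι k, ψ (trace (g : Matrix ι ι k)) * L (π g⁻¹ v) =
      (Nat.card {A : Matrix ι ι k // A * J = J * A} : R) * L (π w⁻¹ v) := by
  have hLH : ∀ g : GL ι k, ∀ h ∈ H, L (π (g * h)⁻¹ v) = L (π g⁻¹ v) := by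
    intro g h hh
    rw [_root_.mul_inv_rev, map_mul, Module.End.mul_apply, hL _ (H.inv_mem hh)]
  have step1 : ∑ g : GL ι k, ψ (trace (g : Matrix ι ι k)) * L (π g⁻¹ v) =
      ∑ q : GL ι k ⧸ H, kerSum ψ J ⊥ (q.out : GL ι k) * L (π q.out⁻¹ v) := by
    rw [sum_eq_sum_quotient_sum H]
    refine Finset.sum_congr rfl fun q _ => ?_
    rw [kerSum, ← sum_subgroup_eq_sum_ker_bot hH fun A => ψ (trace (A * ((q.out : GL ι k) : Matrix ι ι k))),
      Finset.sum_mul]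
    refine Finset.sum_congr rfl fun h _ => ?_
    rw [hLH _ _ h.2, Units.val_mul, Matrix.trace_mul_comm]
  -- Passing from `H` to the whole centralizer algebra is harmless: every other stratum contributes
  -- zero.
  have step2 : ∑ q : GL ι k ⧸ H, (∑ A : Matrix ι ι k with A * J = J * A,
        ψ (trace (A * ((q.out : GL ι k) : Matrix ι ι k)))) * L (π q.out⁻¹ v) =
      ∑ q : GL ι k ⧸ H, kerSum ψ J ⊥ (q.out : GL ι k) * L (π q.out⁻¹ v) := by
    have hfib : ∀ g : GL ι k, (∑ A : Matrix ι ι k with A * J = J * A,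
        ψ (trace (A * (g : Matrix ι ι k)))) =
        ∑ W : Submodule k (ι → k), kerSum ψ J W g := by
      intro g
      rw [← Finset.sum_fiberwise _ fun A : Matrix ι ι k => LinearMap.ker A.mulVecLin]
      simp only [Finset.filter_filter, kerSum]
    simp only [hfib, Finset.sum_mul]
    rw [Finset.sum_comm, Finset.sum_eq_single ⊥]
    · intro W _ hW
      exact sum_quotient_kerSum_eq_zero hψ hcusp hH hL v W hW
    · simp
  -- Only the coset `wH` survives: if `q` also anticommutes with `J`, then `w⁻¹ q` commutes with it.
  rw [step1, ← step2, Finset.sum_eq_single (w : GL ι k ⧸ H)]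
  · obtain ⟨h, hh⟩ := QuotientGroup.mk_out_eq_mul H w
    have h3 : ((w * h : GL ι k) : Matrix ι ι k) * J = -(J * ((w * h : GL ι k) : Matrix ι ι k)) := by
      rw [Units.val_mul, Matrix.mul_assoc, (hH h).1 h.2, ← Matrix.mul_assoc, hw, Matrix.neg_mul,
        Matrix.mul_assoc]
    rw [hh, sum_centralizer hψ h2 hα hJ, if_pos h3, hLH _ _ h.2]
  · intro q _ hq
    rw [sum_centralizer hψ h2 hα hJ, if_neg, zero_mul]
    intro h3
    apply hq
    rw [← QuotientGroup.out_eq' q]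
    refine (QuotientGroup.eq.2 ((hH _).2 ?_)).symm
    have h4 : ((w⁻¹ : GL ι k) : Matrix ι ι k) * J = -(J * (w⁻¹ : GL ι k)) := by
      have h5 := congrArg
        (fun X => ((w⁻¹ : GL ι k) : Matrix ι ι k) * X * ((w⁻¹ : GL ι k) : Matrix ι ι k)) hw
      simp only [Matrix.mul_neg, Matrix.neg_mul, ← Matrix.mul_assoc, Units.inv_mul,
        Matrix.one_mul] at h5
      simp only [Matrix.mul_assoc, Units.mul_inv, Matrix.mul_one] at h5
      rw [h5, neg_neg]
    rw [Units.val_mul, Matrix.mul_assoc, h3, Matrix.mul_neg, ← Matrix.mul_assoc, h4,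
      Matrix.neg_mul, neg_neg, Matrix.mul_assoc]
  · simp

/-- The main theorem for the centralizer `H` of a square root `J` of a scalar. -/
theorem exists_periodCharacter_gammaFactor [Nontrivial ι] {ψ : AddChar k R} (hψ : ψ ≠ 1)
    {π : Representation R (GL ι k) V} (hirr : IsAbsolutelyIrreducible π) (hcusp : IsCuspidal π)
    {J : Matrix ι ι k} {α : k} (h2 : (2 : k) ≠ 0) (hα : α ≠ 0) (hJ : J * J = α • 1)
    {H : Subgroup (GL ι k)} (hH : ∀ g : GL ι k, g ∈ H ↔ (g : Matrix ι ι k) * J = J * g)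
    (w : Subgroup.normalizer (H : Set (GL ι k)))
    (hw : ((w : GL ι k) : Matrix ι ι k) * J = -(J * (w : GL ι k)))
    (hww : (w : GL ι k)⁻¹ = w) (hdist : IsDistinguished π H) {s : R}
    (hs : s = (Nat.card {A : Matrix ι ι k // A * J = J * A} : ℕ)) :
    ∃ χ : Subgroup.normalizer (H : Set (GL ι k)) →* Rˣ,
      IsPeriodCharacter π H χ ∧ SatisfiesFunctionalEquation ψ s π ∧
        gammaFactor ψ s π = χ w := by
  obtain ⟨c, hc⟩ := hirr.exists_eq_smul (gaussSumOp ψ s π) (gaussSumOp_comm ψ s π)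
  have hs0 : s ≠ 0 := hs ▸ card_centralizer_ne_zero hψ J
  have hLw : ∀ L ∈ invariantForms π H, L ∘ₗ π (w : GL ι k) = c • L := by
    intro L hL
    ext v
    have h1 := congrArg L (hc v)
    rw [gaussSumOp_apply] at h1
    simp only [map_smul, map_sum, smul_eq_mul] at h1
    rw [sum_trace_mul_invariantForm hψ hcusp h2 hα hJ hH hw hL, ← hs, hww,
      inv_mul_cancel_left₀ hs0] at h1
    simpa using h1
  -- A scalar `J = a` would have `a ≠ 0`, and anticommuting with `w` would give `2 a w = 0`.
  have hJs : ∀ a : k, J ≠ a • 1 := by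
    rintro a rfl
    rw [Matrix.mul_smul, Matrix.mul_one, Matrix.smul_mul, Matrix.one_mul] at hw
    have h3 : ((2 : k) * a) • ((w : GL ι k) : Matrix ι ι k) = 0 := by
      rw [mul_smul, two_smul]
      nth_rewrite 1 [hw]
      exact neg_add_cancel _
    have ha : a ≠ 0 := by
      rintro rfl
      have h5 := congrFun (congrFun hJ (Classical.arbitrary ι)) (Classical.arbitrary ι)
      simp at h5
      exact hα h5.symm
    have h6 := (smul_eq_zero.1 h3).resolve_left (mul_ne_zero h2 ha)
    exact (w : GL ι k).ne_zero h6
  obtain ⟨χ, hχ⟩ := exists_isPeriodCharacter hdist (by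
    intro n
    rcases commute_or_anticommute_of_mem_normalizer h2 hα hJ hJs hH n.2 with h | h
    · refine ⟨1, fun L hL => ?_⟩
      ext v
      rw [LinearMap.comp_apply, hL _ ((hH _).2 h), one_smul]
    -- Two elements anticommuting with `J` differ by an element of `H`, so `n` acts as `w` does.
    · refine ⟨c, fun L hL => ?_⟩
      have hwn' : (n : GL ι k) * (w : GL ι k)⁻¹ ∈ H := by
        rw [hH, hww, Units.val_mul, Matrix.mul_assoc, hw, Matrix.mul_neg, ← Matrix.mul_assoc, h,
          Matrix.neg_mul, neg_neg, Matrix.mul_assoc]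
      rw [← hLw L hL]
      ext v
      have h7 : (n : GL ι k) = (n * (w : GL ι k)⁻¹) * w := by group
      rw [LinearMap.comp_apply, h7, map_mul, Module.End.mul_apply, hL _ hwn']
      rfl)
  have hfe : FunctionalEquation ψ s π c := functionalEquation_of_gaussSumOp hc
  obtain ⟨L₀, hL₀, hne⟩ := (Submodule.ne_bot_iff _).1 hdist
  have : Nontrivial V := by
    by_contra h
    rw [not_nontrivial_iff_subsingleton] at h
    exact hne (LinearMap.ext fun v => by rw [Subsingleton.elim v 0, map_zero, map_zero])
  refine ⟨χ, hχ, ⟨c, hfe⟩, ?_⟩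
  rw [gammaFactor_eq hfe]
  exact smul_left_injective R hne ((hLw L₀ hL₀).symm.trans (hχ w L₀ hL₀))

end Distinguished

/-! ### Both models as centralizers -/

section Models

variable {k : Type*} [Field k]

/-- The inverse of a unit commuting with `J` commutes with `J` too, so both lie in the image of `f`,
and injectivity lifts them to mutually inverse elements. -/
theorem mem_range_unitsMap_iff {A B : Type*} [Ring A] [Ring B] {f : A →+* B}
    (hf : Function.Injective f) {J : B} (hrange : ∀ X, X ∈ f.range ↔ X * J = J * X) (g : Bˣ) :
    g ∈ (Units.map f.toMonoidHom).range ↔ (g : B) * J = J * g := by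
  constructor
  · rintro ⟨a, rfl⟩
    exact (hrange _).1 ⟨a, rfl⟩
  · intro hg
    have hg' : ((g⁻¹ : Bˣ) : B) * J = J * (g⁻¹ : Bˣ) :=
      (show Commute (g : B) J from hg).units_inv_left
    obtain ⟨a, ha⟩ := (hrange _).2 hg
    obtain ⟨b, hb⟩ := (hrange _).2 hg'
    refine ⟨⟨a, b, hf ?_, hf ?_⟩, Units.ext ha⟩
    · rw [map_mul, ha, hb, Units.mul_inv, map_one]
    · rw [map_mul, ha, hb, Units.inv_mul, map_one]

theorem natCard_range_eq {A B : Type*} [Ring A] [Ring B] {f : A →+* B}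
    {J : B} (hrange : ∀ X, X ∈ f.range ↔ X * J = J * X) :
    Nat.card f.range = Nat.card {X : B // X * J = J * X} :=
  Nat.card_congr (Equiv.subtypeEquivRight hrange)

theorem linearEmb_injective (m : ℕ) : Function.Injective (linearEmb k m) := by
  intro A B h
  obtain ⟨h1, -, -, h2⟩ := Matrix.fromBlocks_inj.1 (show Matrix.fromBlocks A.1 0 0 A.2 =
    Matrix.fromBlocks B.1 0 0 B.2 from h)
  exact Prod.ext h1 h2

theorem mem_range_linearEmb_iff (h2 : (2 : k) ≠ 0) (m : ℕ)
    (X : Matrix (Fin m ⊕ Fin m) (Fin m ⊕ Fin m) k) :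
    X ∈ (linearEmb k m).range ↔
      X * Matrix.fromBlocks 1 0 0 (-1) = Matrix.fromBlocks 1 0 0 (-1) * X := by
  constructor
  · rintro ⟨A, rfl⟩
    change Matrix.fromBlocks A.1 0 0 A.2 * _ = _ * Matrix.fromBlocks A.1 0 0 A.2
    simp [Matrix.fromBlocks_multiply]
  · intro h
    rw [← Matrix.fromBlocks_toBlocks X, Matrix.fromBlocks_multiply, Matrix.fromBlocks_multiply,
      Matrix.fromBlocks_inj] at h
    obtain ⟨-, h3, h4, -⟩ := h
    simp only [Matrix.mul_zero, Matrix.mul_neg, Matrix.mul_one, Matrix.one_mul, Matrix.zero_mul,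
      Matrix.neg_mul, zero_add, add_zero] at h3 h4
    have hzero : ∀ B : Matrix (Fin m) (Fin m) k, -B = B → B = 0 := by
      intro B hB
      have h5 : (2 : k) • B = 0 := by
        rw [two_smul]
        nth_rewrite 1 [← hB]
        exact neg_add_cancel B
      exact (smul_eq_zero.1 h5).resolve_left h2
    refine ⟨(X.toBlocks₁₁, X.toBlocks₂₂), ?_⟩
    change Matrix.fromBlocks X.toBlocks₁₁ 0 0 X.toBlocks₂₂ = X
    conv_rhs => rw [← Matrix.fromBlocks_toBlocks X, hzero _ h3, hzero _ h4.symm]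

theorem twistedEmb_injective (m : ℕ) (α : k) : Function.Injective (twistedEmb k m α) := by
  intro A B h
  obtain ⟨h1, h2, -, -⟩ := Matrix.fromBlocks_inj.1 (show Matrix.fromBlocks
    (A.map QuadraticAlgebra.re) (A.map QuadraticAlgebra.im) (α • A.map QuadraticAlgebra.im)
    (A.map QuadraticAlgebra.re) = Matrix.fromBlocks (B.map QuadraticAlgebra.re)
    (B.map QuadraticAlgebra.im) (α • B.map QuadraticAlgebra.im) (B.map QuadraticAlgebra.re) from h)
  ext i j
  · exact congrFun (congrFun h1 i) j
  · exact congrFun (congrFun h2 i) j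

theorem mem_range_twistedEmb_iff (α : k) (m : ℕ)
    (X : Matrix (Fin m ⊕ Fin m) (Fin m ⊕ Fin m) k) :
    X ∈ (twistedEmb k m α).range ↔
      X * Matrix.fromBlocks 0 1 (α • 1) 0 = Matrix.fromBlocks 0 1 (α • 1) 0 * X := by
  constructor
  · rintro ⟨A, rfl⟩
    change Matrix.fromBlocks (A.map QuadraticAlgebra.re) (A.map QuadraticAlgebra.im)
      (α • A.map QuadraticAlgebra.im) (A.map QuadraticAlgebra.re) * _ =
      _ * Matrix.fromBlocks (A.map QuadraticAlgebra.re) (A.map QuadraticAlgebra.im)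
      (α • A.map QuadraticAlgebra.im) (A.map QuadraticAlgebra.re)
    simp [Matrix.fromBlocks_multiply]
  · intro h
    rw [← Matrix.fromBlocks_toBlocks X, Matrix.fromBlocks_multiply, Matrix.fromBlocks_multiply,
      Matrix.fromBlocks_inj] at h
    -- The two upper block equations already determine the lower blocks.
    obtain ⟨h1, h2, -, -⟩ := h
    simp only [Matrix.mul_zero, Matrix.mul_smul, Matrix.mul_one, Matrix.one_mul, Matrix.zero_mul,
      zero_add, add_zero] at h1 h2
    refine ⟨Matrix.of fun i j => ⟨X.toBlocks₁₁ i j, X.toBlocks₁₂ i j⟩, ?_⟩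
    change Matrix.fromBlocks X.toBlocks₁₁ X.toBlocks₁₂ (α • X.toBlocks₁₂) X.toBlocks₁₁ = X
    conv_rhs => rw [← Matrix.fromBlocks_toBlocks X, ← h1, ← h2]

end Models

end GJ

theorem mainTheorem2
    {k : Type*} [Field k] [Fintype k] [DecidableEq k]
    {R : Type*} [Field R] {V : Type*} [AddCommGroup V] [Module R V]
    (m : ℕ) (hm : 1 ≤ m)
    (π : Representation R (GL (Fin m ⊕ Fin m) k) V)
    (hirr : GJ.IsAbsolutelyIrreducible π) (hcusp : GJ.IsCuspidal π)
    (ψ : AddChar k R) (hψ : ψ ≠ 1) :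
    (ringChar k ≠ 2 → GJ.IsDistinguished π (GJ.linearH k m) →
      ∃ χ : Subgroup.normalizer (GJ.linearH k m : Set (GL (Fin m ⊕ Fin m) k)) →* Rˣ,
        GJ.IsPeriodCharacter π (GJ.linearH k m) χ ∧
        GJ.SatisfiesFunctionalEquation ψ (Nat.card (GJ.linearAlg k m) : R) π ∧
        GJ.gammaFactor ψ (Nat.card (GJ.linearAlg k m) : R) π
          = χ ⟨GJ.antidiagW k m, GJ.antidiagW_mem_normalizer k m⟩) ∧
    (∀ α : k, ¬ IsSquare α → GJ.IsDistinguished π (GJ.twistedH k m α) →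
      ∃ χ : Subgroup.normalizer (GJ.twistedH k m α : Set (GL (Fin m ⊕ Fin m) k)) →* Rˣ,
        GJ.IsPeriodCharacter π (GJ.twistedH k m α) χ ∧
        GJ.SatisfiesFunctionalEquation ψ (Nat.card (GJ.twistedAlg k m α) : R) π ∧
        GJ.gammaFactor ψ (Nat.card (GJ.twistedAlg k m α) : R) π
          = χ ⟨GJ.diagW k m, GJ.diagW_mem_normalizer k m α⟩) := by
  have : Nontrivial (Fin m ⊕ Fin m) := ⟨Sum.inl ⟨0, hm⟩, Sum.inr ⟨0, hm⟩, Sum.inl_ne_inr⟩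
  constructor
  · intro hchar hdist
    have h2 : (2 : k) ≠ 0 := Ring.two_ne_zero hchar
    refine GJ.exists_periodCharacter_gammaFactor hψ hirr hcusp
      (J := Matrix.fromBlocks 1 0 0 (-1)) h2 one_ne_zero ?_
      (GJ.mem_range_unitsMap_iff (GJ.linearEmb_injective m) (GJ.mem_range_linearEmb_iff h2 m))
      _ ?_ rfl hdist
      (congrArg _ (GJ.natCard_range_eq (GJ.mem_range_linearEmb_iff h2 m)))
    · simp [Matrix.fromBlocks_multiply]
    · change Matrix.fromBlocks 0 1 1 0 * _ = -(_ * Matrix.fromBlocks 0 1 1 0)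
      simp [Matrix.fromBlocks_multiply, Matrix.fromBlocks_neg]
  · intro α hα hdist
    have hα0 : α ≠ 0 := by
      rintro rfl
      exact hα (IsSquare.zero)
    -- In a finite field of characteristic two every element is a square.
    have h2 : (2 : k) ≠ 0 :=
      Ring.two_ne_zero fun h => hα (FiniteField.isSquare_of_char_two h α)
    refine GJ.exists_periodCharacter_gammaFactor hψ hirr hcusp
      (J := Matrix.fromBlocks 0 1 (α • 1) 0) h2 hα0 ?_
      (GJ.mem_range_unitsMap_iff (GJ.twistedEmb_injective m α)
        (GJ.mem_range_twistedEmb_iff α m))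
      _ ?_ rfl hdist
      (congrArg _ (GJ.natCard_range_eq (GJ.mem_range_twistedEmb_iff α m)))
    · rw [← Matrix.fromBlocks_one, Matrix.fromBlocks_smul]
      simp [Matrix.fromBlocks_multiply]
    · change Matrix.fromBlocks 1 0 0 (-1) * _ = -(_ * Matrix.fromBlocks 1 0 0 (-1))
      simp [Matrix.fromBlocks_multiply, Matrix.fromBlocks_neg]
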